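/- Let $G_1=(V_1,E_1)$ and $G_2=(V_2,E_2)$ be finite directed acyclic graphs and let $\beta=\{(a,b,w_{ab}) : a\in V_1,\ b\in V_2\}$, with one (rational) weight $w_{ab}\in[0,1]$ for every pair. For a vertex $v$ let $\mathrm{anc}(v)$ be the set of its ancestors (the vertices from which there is a directed path to $v$) and $\mathrm{desc}(v)$ the set of its descendants (the vertices to which there is a directed path from $v$). For $e=(a,b,w_e)\in\beta$ let $\mathrm{conf}(e)$ be the set of all $d=(f,g,w_d)\in\beta$ with $d\ne e$ such that at least one of the following holds: $a\in\mathrm{anc}(f)$ and $b\notin\mathrm{anc}(g)$; $a\in\mathrm{desc}(f)$ and $b\notin\mathrm{desc}(g)$; $a=f$; $b=g$. An alignment is a set $M\subseteq\beta$ in which every vertex appears at most once and such that $\mathrm{conf}(e)\cap M=\emptyset$ for every $e\in M$; its weight $w(M)$ is the sum of the weights of its edges. The DAG alignment problem is to find an alignment of maximum weight. Theorem. DAG alignment can be approximated in polynomial time within a factor $O(m/\log^2 m)$, where $m=|\beta|$. That is, there are a function $\rho:\mathbb N\to\mathbb R$ with $\rho(m)=O(m/\log^2 m)$ as $m\to\infty$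 and a deterministic polynomial-time algorithm that, given $G_1$, $G_2$ and the weights (as fractions, in binary), outputs an alignment $A$ such that $w(M)\le\rho(|\beta|)\,w(A)$ for every alignment $M$. -/

import Mathlib

namespace DagAlignment

/-- A finite directed acyclic graph on the vertices `0, …, n - 1`, given by its set of edges. -/
structure DAG where
  /-- the number of vertices -/
  n : ℕ
  /-- the set of directed edges -/
  E : Finset (Fin n × Fin n)
  /-- there are no oriented cycles -/
  acyclic : ∀ v, ¬ Relation.TransGen (fun a b => (a, b) ∈ E) v v

namespace DAG

/-- The vertices of a DAG. -/
abbrev V (G : DAG) : Type := Fin G.n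

/-- `G.Path a b`: there is a directed path (with at least one edge) from `a` to `b`. -/
def Path (G : DAG) : G.V → G.V → Prop :=
  Relation.TransGen (fun a b => (a, b) ∈ G.E)

/-- The ancestors of `v`. -/
def anc (G : DAG) (v : G.V) : Set G.V := {a | G.Path a v}

/-- The descendants of `v`. -/
def desc (G : DAG) (v : G.V) : Set G.V := {d | G.Path v d}

end DAG

/-- An instance of DAG alignment: two DAGs and a weight in `[0, 1]` for every pair of vertices.
Weights are rational, so that an instance is a finite object. -/
structure Instance where
  /-- the first DAG -/
  G₁ : DAG
  /-- the second DAG -/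
  G₂ : DAG
  /-- the weight of the candidate edge between a vertex of `G₁` and one of `G₂` -/
  w : G₁.V → G₂.V → ℚ
  /-- weights are in the unit interval -/
  w_mem : ∀ i j, w i j ∈ Set.Icc (0 : ℚ) 1

namespace Instance

variable (I : Instance)

/-- Weighted edges between the two vertex sets, as triples (vertex, vertex, weight). -/
abbrev Edge : Type := I.G₁.V × I.G₂.V × ℚ

/-- The set `β` of candidate edges: one triple for every pair of vertices. -/
def beta : Finset I.Edge :=
  Finset.univ.image (fun p : I.G₁.V × I.G₂.V => (p.1, p.2, I.w p.1 p.2))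

/-- The edge `d = (f, g, w_d)` is an edge conflict for the edge `e = (a, b, w_e)`. -/
def IsConflict (e d : I.Edge) : Prop :=
  d ≠ e ∧
    ((e.1 ∈ I.G₁.anc d.1 ∧ e.2.1 ∉ I.G₂.anc d.2.1) ∨
     (e.1 ∈ I.G₁.desc d.1 ∧ e.2.1 ∉ I.G₂.desc d.2.1) ∨
     e.1 = d.1 ∨
     e.2.1 = d.2.1)

/-- The set of the candidate edges that are edge conflicts for `e`. -/
def conf (e : I.Edge) : Set I.Edge := {d | d ∈ I.beta ∧ I.IsConflict e d}

/-- The feasible solutions: sets `M ⊆ β` of edges in which every vertex appears at most once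
(matchings) and that obey the hierarchical constraint. -/
structure IsAlignment (M : Finset I.Edge) : Prop where
  /-- only candidate edges are used -/
  subset : M ⊆ I.beta
  /-- every vertex appears in at most one edge -/
  matching : ∀ e ∈ M, ∀ d ∈ M, e ≠ d → e.1 ≠ d.1 ∧ e.2.1 ≠ d.2.1
  /-- the hierarchical constraint -/
  hierarchical : ∀ e ∈ M, I.conf e ∩ (M : Set I.Edge) = ∅

/-- The total weight of a set of edges. -/
def weight (M : Finset I.Edge) : ℚ := ∑ e ∈ M, e.2.2

end Instance

/-! ### Encodings

Words over the alphabet `Computability.Γ'` (bits, brackets, comma, blank). -/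

open Computability

/-- A DAG is written as its adjacency matrix, each row in brackets. -/
def encodeDAG (G : DAG) : List Γ' :=
  (List.finRange G.n).flatMap fun a =>
    Γ'.bra :: (List.finRange G.n).map (fun b => Γ'.bit (decide ((a, b) ∈ G.E))) ++ [Γ'.ket]

/-- A nonnegative rational is written as numerator and denominator in binary. -/
def encodeWeight (q : ℚ) : List Γ' :=
  Γ'.bra :: q.num.natAbs.bits.map Γ'.bit ++ Γ'.comma :: q.den.bits.map Γ'.bit ++ [Γ'.ket]

/-- The input word of an instance: the two DAGs and then the matrix of the weights,
row by row. -/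
def encodeInstance (I : Instance) : List Γ' :=
  encodeDAG I.G₁ ++ Γ'.comma :: encodeDAG I.G₂ ++ Γ'.comma ::
    (List.finRange I.G₁.n).flatMap fun i =>
      (List.finRange I.G₂.n).flatMap fun j => encodeWeight (I.w i j)

/-- The output word of a set `M` of candidate edges: the 0/1 matrix, row by row, that tells
which of the candidate edges are in `M`. -/
def encodeSolution (I : Instance) (M : Finset I.Edge) : List Bool :=
  (List.finRange I.G₁.n).flatMap fun i =>
    (List.finRange I.G₂.n).map fun j => decide ((i, j, I.w i j) ∈ M)

/-- The map `A`, which assigns to every instance a set of edges, is computed by a (multi-stack)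
Turing machine in time polynomial in the length of the input word. -/
def IsPolyTime (A : (I : Instance) → Finset I.Edge) : Prop :=
  Nonempty (Turing.TM2ComputableInPolyTime encodeInstance (id : List Bool → List Bool)
    (fun I => encodeSolution I (A I)))

/-- DAG alignment can be approximated in polynomial time with performance guarantee `ρ`, a
function of the number of candidate edges: a polynomial time algorithm finds for every instance
a feasible solution such that no feasible solution has more than `ρ |β|` times its weight. -/
def ApproximableWithin (ρ : ℕ → ℝ) : Prop :=
  ∃ A : (I : Instance) → Finset I.Edge,
    IsPolyTime A ∧
    ∀ I : Instance, I.IsAlignment (A I) ∧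
      ∀ M : Finset I.Edge, I.IsAlignment M →
        (I.weight M : ℝ) ≤ ρ I.beta.card * (I.weight (A I) : ℝ)

end DagAlignment

/-!
Every pair of vertices carries a candidate edge, so `|β| = n₁ n₂`, while an alignment is a matching
and has at most `min n₁ n₂ ≤ √|β|` edges (`Instance.IsAlignment.card_sq_le`). Hence a single edge of
maximum weight, which is an alignment by itself, is within a factor `√|β|` of the optimum, and an
edge whose weight is maximal up to a factor `4` is within `4 √|β| = O(|β| / log² |β|)`
(`isBigO_sqrt`).

Such an edge is found without multiplication: for a nonzero weight `p / q` the number of binary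
digits of `q` minus that of `p`, its `cost`, is `-log₂ (p / q)` up to an error less than `1`, so a
nonzero weight of least cost is maximal up to a factor `4` (`le_four_mul_of_cost_le`). A stack
machine reads the weights once, keeps the least cost so far as a unary counter, and records for
every weight whether it improved on it; the last improvement is the chosen edge, and the record is
turned into the output while it is reversed. The number of steps is linear in the length of the
input (`Machine.run`), because the work of a round is paid for by the digits that it reads and by
the decrease of the counter.
-/

namespace DagAlignment

open Computability StateTransition Turing

/-! ### Weights of least cost -/

section Choice

/-- The difference of the binary lengths of denominator and numerator of `q`. For `0 < q ≤ 1` this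
is `-log₂ q` up to an error less than `1`. -/
def cost (q : ℚ) : ℕ := q.den.bits.length - q.num.natAbs.bits.length

lemma length_bits_num_le {q : ℚ} (hq : q ∈ Set.Icc (0 : ℚ) 1) :
    q.num.natAbs.bits.length ≤ q.den.bits.length := by
  rw [Nat.size_eq_bits_len, Nat.size_eq_bits_len]
  apply Nat.size_le_size
  have h := Rat.num_le_denom_iff.2 hq.2
  have h0 := Rat.num_nonneg.2 hq.1
  omega

lemma le_four_mul_of_cost_le {a b : ℚ} (ha : a ∈ Set.Icc (0 : ℚ) 1) (hb : b ∈ Set.Icc (0 : ℚ) 1)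
    (ha0 : a ≠ 0) (hb0 : b ≠ 0) (h : cost a ≤ cost b) : b ≤ 4 * a := by
  -- the error bound `2 ^ (-cost q - 1) ≤ q ≤ 2 ^ (1 - cost q)`
  have key : ∀ q : ℚ, q ∈ Set.Icc (0 : ℚ) 1 → q ≠ 0 →
      1 ≤ 2 * 2 ^ cost q * q ∧ 2 ^ cost q * q ≤ 2 := by
    intro q hq hq0
    have hle := length_bits_num_le hq
    have hc : cost q + q.num.natAbs.size = q.den.size := by
      rw [Nat.size_eq_bits_len, Nat.size_eq_bits_len] at hle
      rw [cost, Nat.size_eq_bits_len, Nat.size_eq_bits_len]; omega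
    have hn0 : q.num.natAbs ≠ 0 := by simpa using hq0
    have hn : (q.num.natAbs : ℚ) = q * q.den := by
      have h0 := Rat.num_nonneg.2 hq.1
      rw [Rat.mul_den_eq_num, ← Int.cast_natCast, Int.natAbs_of_nonneg h0]
    have hd : (0 : ℚ) < q.den := by exact_mod_cast q.den_pos
    obtain ⟨s, hs⟩ : ∃ s, q.num.natAbs.size = s + 1 :=
      Nat.exists_eq_succ_of_ne_zero (by simpa [Nat.size_eq_zero] using hn0)
    have n1 : 2 ^ s ≤ q.num.natAbs := Nat.lt_size.1 (by omega)
    have n2 : q.num.natAbs < 2 ^ (s + 1) := hs ▸ Nat.lt_size_self _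
    have d1 : 2 ^ (cost q + s) ≤ q.den := Nat.lt_size.1 (by omega)
    have d2 : q.den < 2 ^ (cost q + s + 1) := by
      have := Nat.lt_size_self q.den
      rwa [← hc, hs, ← add_assoc] at this
    have n1' : (2 : ℚ) ^ s ≤ q * q.den := by rw [← hn]; exact_mod_cast n1
    have n2' : q * q.den ≤ 2 ^ s * 2 := by rw [← hn]; exact_mod_cast n2.le
    have d1' : (2 : ℚ) ^ cost q * 2 ^ s ≤ q.den := by rw [← pow_add]; exact_mod_cast d1
    have d2' : (q.den : ℚ) ≤ 2 ^ cost q * 2 ^ s * 2 := by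
      rw [← pow_add, ← pow_succ]; exact_mod_cast d2.le
    have hc0 : (0 : ℚ) < 2 ^ cost q := by positivity
    constructor
    · refine le_of_mul_le_mul_right ?_ hd
      nlinarith
    · have hs0 : (0 : ℚ) < 2 ^ s := by positivity
      refine le_of_mul_le_mul_right (a := 2 ^ s) ?_ hs0
      have := mul_le_mul_of_nonneg_left d1' hq.1
      nlinarith
  have h1 := (key a ha ha0).1
  have h2 := (key b hb hb0).2
  have h3 : (2 : ℚ) ^ cost a ≤ 2 ^ cost b := pow_le_pow_right₀ (by norm_num) h
  have hb1 : (2 : ℚ) ^ cost a * b ≤ 2 := (mul_le_mul_of_nonneg_right h3 hb.1).trans h2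
  refine le_of_mul_le_mul_left (a := 2 ^ cost a) ?_ (by positivity)
  linarith

variable {α : Type*}

/-- The first element of `l` with the least `cost` of its value, among those with nonzero value. -/
def best (v : α → ℚ) (l : List α) : Option α :=
  (l.filter fun a => v a ≠ 0).argmin fun a => cost (v a)

variable {v : α → ℚ} {l : List α} {a b : α}

lemma best_mem (h : best v l = some b) : b ∈ l :=
  List.mem_of_mem_filter (List.argmin_mem h)

lemma best_ne_zero (h : best v l = some b) : v b ≠ 0 := by
  simpa using (List.mem_filter.1 (List.argmin_mem (Option.mem_def.2 h))).2

lemma best_cost_le (h : best v l = some b) (ha : a ∈ l) (h0 : v a ≠ 0) :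
    cost (v b) ≤ cost (v a) :=
  List.le_of_mem_argmin (f := fun a => cost (v a)) (List.mem_filter.2 ⟨ha, by simpa using h0⟩) h

lemma eq_zero_of_best_eq_none (h : best v l = none) (ha : a ∈ l) : v a = 0 := by
  have := List.filter_eq_nil_iff.1 (List.argmin_eq_none.1 h) a ha
  simpa using this

lemma best_concat_of_zero (h : v a = 0) : best v (l ++ [a]) = best v l := by
  simp [best, h]

lemma best_concat_of_none (h : v a ≠ 0) (hl : best v l = none) :
    best v (l ++ [a]) = some a := by
  have hf : (l ++ [a]).filter (fun a => v a ≠ 0) = l.filter (fun a => v a ≠ 0) ++ [a] := by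
    simp [h]
  rw [best, hf, List.argmin_concat]
  rw [best] at hl
  rw [hl]

lemma best_concat_of_some (h : v a ≠ 0) (hl : best v l = some b) :
    best v (l ++ [a]) = if cost (v a) < cost (v b) then some a else some b := by
  have hf : (l ++ [a]).filter (fun a => v a ≠ 0) = l.filter (fun a => v a ≠ 0) ++ [a] := by
    simp [h]
  rw [best, hf, List.argmin_concat]
  rw [best] at hl
  rw [hl]

variable [DecidableEq α]

/-- The 0/1 list that marks the chosen element `best v l` in `l`. -/
def indicator (v : α → ℚ) (l : List α) : List Bool :=
  l.map fun a => decide (best v l = some a)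

/-- Keeps only the first `true` of a list. The record of improvements is kept on a stack, with the
latest one first, so that its first `true` belongs to the chosen element. -/
def keepFirst : List Bool → List Bool
  | [] => []
  | true :: s => true :: List.replicate s.length false
  | false :: s => false :: keepFirst s

lemma length_keepFirst (s : List Bool) : (keepFirst s).length = s.length := by
  induction s with
  | nil => rfl
  | cons b s ih => cases b <;> simp [keepFirst, ih]

lemma indicator_concat_of_eq (ha : a ∉ l) (h : best v (l ++ [a]) = best v l) :
    (indicator v (l ++ [a])).reverse = false :: (indicator v l).reverse := by
  have : best v l ≠ some a := fun h' => ha (best_mem h')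
  simp [indicator, h, this]

/-- When the last element becomes the chosen one, no earlier mark is kept. -/
lemma indicator_concat_of_some (ha : a ∉ l) (h : best v (l ++ [a]) = some a) :
    (indicator v (l ++ [a])).reverse = true :: List.replicate l.length false := by
  have : l.map (fun x => decide (a = x)) = List.replicate l.length false := by
    rw [List.eq_replicate_iff]
    refine ⟨by simp, ?_⟩
    simp only [List.mem_map, forall_exists_index, and_imp, forall_apply_eq_imp_iff₂]
    rintro b hb
    simp only [decide_eq_false_iff_not]
    rintro rfl
    exact ha hb
  simp [indicator, h, this]

end Choice

/-! ### The stack machine -/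

namespace Machine

/-- The stacks of the machine. -/
inductive K
  /-- the input -/
  | inp
  /-- a scratch counter -/
  | c
  /-- the counter for the cost of the current weight -/
  | d
  /-- the counter for the least cost so far -/
  | b
  /-- one bit for every weight that has been read: did it improve on the least cost? -/
  | s
  /-- the output -/
  | out
  deriving DecidableEq

instance : Fintype K := ⟨{.inp, .c, .d, .b, .s, .out}, by rintro ⟨⟩ <;> simp⟩

/-- The alphabets of the stacks. Counters are kept in unary. -/
abbrev Γ : K → Type
  | .inp => Γ'
  | .c | .d | .b => Unit
  | .s | .out => Bool

/-- The labels of the machine. -/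
inductive Λ
  /-- skip the first graph -/
  | skip₁
  /-- skip the second graph -/
  | skip₂
  /-- read the bracket that opens a weight -/
  | start
  /-- count the digits of the numerator in `c` -/
  | num
  /-- skip the denominator after a numerator without digits -/
  | zero
  /-- put the cost of the weight in `d` -/
  | den
  /-- compare `d` with `b` and put the minimum in `c` -/
  | cmp
  /-- empty `d` and `b` -/
  | flush
  /-- move `c` to `b` -/
  | restore
  /-- empty `b` at the end -/
  | fin
  /-- write the output: keep the last mark only -/
  | emit
  deriving DecidableEq

instance : Fintype Λ :=
  ⟨{.skip₁, .skip₂, .start, .num, .zero, .den, .cmp, .flush, .restore, .fin, .emit},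
    by rintro ⟨⟩ <;> simp⟩

/-- The internal states of the machine. -/
structure σ where
  /-- the last letter read from the input -/
  r : Option Γ'
  /-- a scratch bit -/
  x : Bool
  /-- another scratch bit -/
  y : Bool
  /-- While the weights are read: there was no nonzero weight so far, so that the empty counter `b`
  stands for an infinite cost. While the output is written: no mark was written so far. -/
  fresh : Bool
  deriving Fintype

/-- The state in which nothing but the flag `fresh` is remembered. -/
def clean (f : Bool) : σ := ⟨none, false, false, f⟩

open TM2.Stmt

/-- Go to a label with a clean state. -/
def next (l : Λ) : TM2.Stmt Γ Λ σ :=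
  load (fun v => clean v.fresh) (goto fun _ => l)

/-- Was the last letter read a bit? -/
def isBit (v : σ) : Bool :=
  match v.r with
  | some (.bit _) => true
  | _ => false

/-- Read a letter of the input. -/
def read (q : TM2.Stmt Γ Λ σ) : TM2.Stmt Γ Λ σ :=
  pop .inp (fun v r => { v with r := r }) q

/-- The program. -/
def prog : Λ → TM2.Stmt Γ Λ σ
  | .skip₁ => read <| branch (fun v => v.r = some .comma) (next .skip₂) (next .skip₁)
  | .skip₂ => read <| branch (fun v => v.r = some .comma) (next .start) (next .skip₂)
  | .start => read <| branch (fun v => v.r = some .bra) (next .num) (next .fin)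
  | .num => read <| branch isBit (push .c (fun _ => ()) (next .num)) <|
      peek .c (fun v t => { v with x := t.isSome }) <|
      branch (fun v => v.x) (next .den) (next .zero)
  | .zero => read <| branch (fun v => v.r = some .ket)
      (push .s (fun _ => false) (next .start)) (next .zero)
  | .den => read <| branch isBit
      (pop .c (fun v t => { v with x := t.isSome }) <|
        branch (fun v => v.x) (next .den) (push .d (fun _ => ()) (next .den)))
      (next .cmp)
  | .cmp => pop .d (fun v t => { v with x := t.isSome }) <|
      pop .b (fun v t => { v with y := t.isSome || v.fresh }) <|
      branch (fun v => v.x && v.y) (push .c (fun _ => ()) (next .cmp)) <|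
      push .s (fun v => v.y) <| load (fun v => { v with fresh := false }) (next .flush)
  | .flush => pop .d (fun v t => { v with x := t.isSome }) <|
      pop .b (fun v t => { v with y := t.isSome }) <|
      branch (fun v => v.x || v.y) (next .flush) (next .restore)
  | .restore => pop .c (fun v t => { v with x := t.isSome }) <|
      branch (fun v => v.x) (push .b (fun _ => ()) (next .restore)) (next .start)
  | .fin => pop .b (fun v t => { v with x := t.isSome }) <|
      branch (fun v => v.x) (next .fin) (load (fun v => { v with fresh := true }) (next .emit))
  | .emit => pop .s (fun v t => { v with x := t.isSome, y := t.getD false }) <|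
      branch (fun v => v.x)
        (push .out (fun v => v.y && v.fresh) <|
          load (fun v => { v with fresh := v.fresh && !v.y }) (next .emit))
        (load (fun _ => clean true) halt)

/-- The stack machine. The alphabets of all its stacks are finite, although `FinTM2` asks for this
only on the input stack. -/
def tm : FinTM2 where
  K := K
  k₀ := .inp
  k₁ := .out
  Γ := Γ
  Λ := Λ
  main := .skip₁
  σ := σ
  initialState := clean true
  Γk₀Fin := inferInstanceAs (Fintype Γ')
  m := prog

/-! ### Runs of the machine -/

/-- The contents of the stacks. -/
def stk (i : List Γ') (c d b : ℕ) (s o : List Bool) : ∀ k, List (Γ k)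
  | .inp => i
  | .c => List.replicate c ()
  | .d => List.replicate d ()
  | .b => List.replicate b ()
  | .s => s
  | .out => o

section

variable (i i' : List Γ') (c d b n : ℕ) (s s' o o' : List Bool)

@[simp] lemma stk_inp : stk i c d b s o .inp = i := rfl
@[simp] lemma stk_c : stk i c d b s o .c = List.replicate c () := rfl
@[simp] lemma stk_d : stk i c d b s o .d = List.replicate d () := rfl
@[simp] lemma stk_b : stk i c d b s o .b = List.replicate b () := rfl
@[simp] lemma stk_s : stk i c d b s o .s = s := rfl
@[simp] lemma stk_out : stk i c d b s o .out = o := rfl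

@[simp] lemma update_inp : Function.update (stk i c d b s o) .inp i' = stk i' c d b s o := by
  funext k; cases k <;> rfl

@[simp] lemma update_c : Function.update (stk i c d b s o) .c
    (List.replicate n () : List Unit) =
    stk i n d b s o := by
  funext k; cases k <;> rfl

@[simp] lemma update_d : Function.update (stk i c d b s o) .d
    (List.replicate n () : List Unit) =
    stk i c n b s o := by
  funext k; cases k <;> rfl

@[simp] lemma update_b : Function.update (stk i c d b s o) .b
    (List.replicate n () : List Unit) =
    stk i c d n s o := by
  funext k; cases k <;> rfl

@[simp] lemma update_s : Function.update (stk i c d b s o) .s s' = stk i c d b s' o := by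
  funext k; cases k <;> rfl

@[simp] lemma update_out : Function.update (stk i c d b s o) .out o' =
    stk i c d b s o' := by
  funext k; cases k <;> rfl

@[simp] lemma update_c_nil : Function.update (stk i c d b s o) .c ([] : List Unit) =
    stk i 0 d b s o :=
  update_c i c d b 0 s o

@[simp] lemma update_d_nil : Function.update (stk i c d b s o) .d ([] : List Unit) =
    stk i c 0 b s o :=
  update_d i c d b 0 s o

@[simp] lemma update_b_nil : Function.update (stk i c d b s o) .b ([] : List Unit) =
    stk i c d 0 s o :=
  update_b i c d b 0 s o

@[simp] lemma update_c_cons : Function.update (stk i c d b s o) .c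
    (() :: List.replicate n () : List Unit) = stk i (n + 1) d b s o :=
  update_c i c d b (n + 1) s o

@[simp] lemma update_d_cons : Function.update (stk i c d b s o) .d
    (() :: List.replicate n () : List Unit) = stk i c (n + 1) b s o :=
  update_d i c d b (n + 1) s o

@[simp] lemma update_b_cons : Function.update (stk i c d b s o) .b
    (() :: List.replicate n () : List Unit) = stk i c d (n + 1) s o :=
  update_b i c d b (n + 1) s o

end

/-- A configuration with a clean state. -/
def cfg (l : Λ) (f : Bool) (i : List Γ') (c d b : ℕ) (s o : List Bool) :
    TM2.Cfg Γ Λ σ :=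
  ⟨some l, clean f, stk i c d b s o⟩

/-- The machine gets from one configuration to the other in at most `n` steps. -/
def Within (n : ℕ) (x y : TM2.Cfg Γ Λ σ) : Prop := Nonempty (EvalsToInTime (TM2.step prog) x (some y) n)

lemma Within.refl (x : TM2.Cfg Γ Λ σ) : Within 0 x x := ⟨EvalsToInTime.refl _ _⟩

lemma Within.trans {m n : ℕ} {x y z : TM2.Cfg Γ Λ σ} : Within m x y → Within n y z → Within (m + n) x z
  | ⟨h⟩, ⟨h'⟩ => by
    rw [add_comm]
    exact ⟨EvalsToInTime.trans _ _ _ _ _ _ h h'⟩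

lemma Within.mono {m n : ℕ} {x y : TM2.Cfg Γ Λ σ} (h : m ≤ n) : Within m x y → Within n x y
  | ⟨k⟩ => ⟨⟨k.toEvalsTo, k.steps_le_m.trans h⟩⟩

variable (f : Bool) (i : List Γ') (c d b : ℕ) (s o : List Bool)

variable {f i c d b s o} in
lemma Within.one {l : Λ} {y : TM2.Cfg Γ Λ σ}
    (h : TM2.stepAux (prog l) (clean f) (stk i c d b s o) = y) :
    Within 1 (cfg l f i c d b s o) y :=
  ⟨⟨⟨1, congrArg some h⟩, le_rfl⟩⟩

variable {f i c d b s o} in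
lemma Within.head {n : ℕ} {l : Λ} {y z : TM2.Cfg Γ Λ σ}
    (h : TM2.stepAux (prog l) (clean f) (stk i c d b s o) = y) (h' : Within n y z) :
    Within (n + 1) (cfg l f i c d b s o) z :=
  ((Within.one h).trans h').mono (by omega)

attribute [local simp] List.replicate_succ prog read next clean isBit

lemma skip₁_run (w : List Γ') (hw : Γ'.comma ∉ w) :
    Within (w.length + 1) (cfg .skip₁ f (w ++ Γ'.comma :: i) c d b s o)
      (cfg .skip₂ f i c d b s o) := by
  induction w with
  | nil => exact .one (by simp [cfg])
  | cons a w ih =>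
    simp only [List.mem_cons, not_or] at hw
    exact .head (by simp [cfg, Ne.symm hw.1]) (ih hw.2)

lemma skip₂_run (w : List Γ') (hw : Γ'.comma ∉ w) :
    Within (w.length + 1) (cfg .skip₂ f (w ++ Γ'.comma :: i) c d b s o)
      (cfg .start f i c d b s o) := by
  induction w with
  | nil => exact .one (by simp [cfg])
  | cons a w ih =>
    simp only [List.mem_cons, not_or] at hw
    exact .head (by simp [cfg, Ne.symm hw.1]) (ih hw.2)

lemma num_run (p : List Bool) :
    Within p.length (cfg .num f (p.map Γ'.bit ++ i) c d b s o)
      (cfg .num f i (c + p.length) d b s o) := by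
  induction p generalizing c with
  | nil => exact .refl _
  | cons a p ih =>
    rw [show c + (a :: p).length = c + 1 + p.length by simp; omega]
    exact .head (by simp [cfg]) (ih (c + 1))

lemma den_run (p : List Bool) :
    Within p.length (cfg .den f (p.map Γ'.bit ++ i) c d b s o)
      (cfg .den f i (c - p.length) (d + (p.length - c)) b s o) := by
  induction p generalizing c d with
  | nil => simpa using .refl _
  | cons a p ih =>
    cases c with
    | zero =>
      have := ih 0 (d + 1)
      rw [show d + 1 + (p.length - 0) = d + ((a :: p).length - 0) by simp; omega] at this
      exact .head (y := cfg .den f (p.map Γ'.bit ++ i) 0 (d + 1) b s o) (by simp [cfg])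
        (by simpa using this)
    | succ c =>
      exact .head (y := cfg .den f (p.map Γ'.bit ++ i) c d b s o) (by simp [cfg])
        (by simpa using ih c d)

/-- The comparison with the least cost `b` so far, when there is one. The truncated differences are
what remains of the counters; the letter that ends the loop is lost, too. -/
lemma cmp_run :
    Within (min d b + 1) (cfg .cmp false i c d b s o)
      (cfg .flush false i (c + min d b) (d - b - 1) (b - d - 1) (decide (d < b) :: s) o) := by
  induction d generalizing b c with
  | zero =>
    cases b with
    | zero => exact .mono (by simp) (.one (by simp [cfg]))
    | succ b => exact .mono (by simp) (.one (by simp [cfg]))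
  | succ d ih =>
    cases b with
    | zero => exact .mono (by simp) (.one (by simp [cfg]))
    | succ b =>
      have := ih (c + 1) b
      rw [show c + 1 + min d b = c + min (d + 1) (b + 1) by omega] at this
      refine .mono (m := min d b + 1 + 1) (by omega)
        (.head (y := cfg .cmp false i (c + 1) d b s o) (by simp [cfg]) ?_)
      simpa using this

/-- The comparison for the first nonzero weight. -/
lemma cmp_run_fresh :
    Within (d + 1) (cfg .cmp true i c d 0 s o)
      (cfg .flush false i (c + d) 0 0 (true :: s) o) := by
  induction d generalizing c with
  | zero => exact .one (by simp [cfg])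
  | succ d ih =>
    rw [show c + (d + 1) = c + 1 + d by omega]
    exact .head (by simp [cfg]) (ih (c + 1))

lemma flush_run :
    Within (d + b + 1) (cfg .flush f i c d b s o) (cfg .restore f i c 0 0 s o) := by
  induction d generalizing b with
  | zero =>
    induction b with
    | zero => exact .one (by simp [cfg])
    | succ b ih => exact .mono (by omega) (.head (by simp [cfg]) ih)
  | succ d ih =>
    refine .mono (m := d + (b - 1) + 1 + 1) (by omega) (.head ?_ (ih (b - 1)))
    cases b <;> simp [cfg]

lemma restore_run :
    Within (c + 1) (cfg .restore f i c d b s o) (cfg .start f i 0 d (b + c) s o) := by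
  induction c generalizing b with
  | zero => exact .one (by simp [cfg])
  | succ c ih =>
    rw [show b + (c + 1) = b + 1 + c by omega]
    exact .head (by simp [cfg]) (ih (b + 1))

lemma weight_run_zero :
    Within 4 (cfg .start f (encodeWeight 0 ++ i) 0 d b s o)
      (cfg .start f i 0 d b (false :: s) o) := by
  have h : encodeWeight 0 = [.bra, .comma, .bit true, .ket] := by
    simp [encodeWeight]
  rw [h]
  refine .head (y := cfg .num f (.comma :: .bit true :: .ket :: i) 0 d b s o) (by simp [cfg]) ?_
  refine .head (y := cfg .zero f (.bit true :: .ket :: i) 0 d b s o) (by simp [cfg]) ?_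
  refine .head (y := cfg .zero f (.ket :: i) 0 d b s o) (by simp [cfg]) ?_
  exact .one (by simp [cfg])

/-- Up to the comparison, a nonzero weight is read and its cost is put on the counter `d`. -/
lemma weight_run_read {q : ℚ} (hq : q ∈ Set.Icc (0 : ℚ) 1) (h0 : q ≠ 0) :
    Within (encodeWeight q).length (cfg .start f (encodeWeight q ++ i) 0 0 b s o)
      (cfg .cmp f i 0 (cost q) b s o) := by
  have hle := length_bits_num_le hq
  obtain ⟨n, hn⟩ : ∃ n, q.num.natAbs.bits.length = n + 1 := by
    refine Nat.exists_eq_succ_of_ne_zero ?_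
    simpa [Nat.size_eq_bits_len, Nat.size_eq_zero] using h0
  have h2 := num_run f (.comma :: (q.den.bits.map .bit ++ .ket :: i)) 0 0 b s o q.num.natAbs.bits
  have h4 := den_run f (.ket :: i) (0 + q.num.natAbs.bits.length) 0 b s o q.den.bits
  rw [show 0 + q.num.natAbs.bits.length - q.den.bits.length = 0 by omega,
    show 0 + (q.den.bits.length - (0 + q.num.natAbs.bits.length)) = cost q by
      rw [cost]; omega] at h4
  have h1 : Within 1 (cfg .start f (encodeWeight q ++ i) 0 0 b s o)
      (cfg .num f (q.num.natAbs.bits.map .bit ++ .comma :: (q.den.bits.map .bit ++ .ket :: i))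
        0 0 b s o) := .one (by simp [cfg, encodeWeight])
  have h3 : Within 1 (cfg .num f (.comma :: (q.den.bits.map .bit ++ .ket :: i))
      (0 + q.num.natAbs.bits.length) 0 b s o) (cfg .den f (q.den.bits.map .bit ++ .ket :: i)
      (0 + q.num.natAbs.bits.length) 0 b s o) := .one (by simp [cfg, hn, List.replicate_succ])
  have h5 : Within 1 (cfg .den f (.ket :: i) 0 (cost q) b s o)
      (cfg .cmp f i 0 (cost q) b s o) := .one (by simp [cfg])
  exact ((((h1.trans h2).trans h3).trans h4).trans h5).mono (by simp [encodeWeight]; omega)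

variable {α : Type*}

/-- The least cost so far, or `0` as long as there is no nonzero weight. -/
def leastCost (v : α → ℚ) (l : List α) : ℕ := (best v l).elim 0 fun a => cost (v a)

/-- One round of the main loop. Emptying the counter `b` is paid for by the decrease of the least
cost. -/
lemma weight_run [DecidableEq α] {v : α → ℚ} {l : List α} {a : α} (ha : a ∉ l)
    (hv : v a ∈ Set.Icc (0 : ℚ) 1) (hs : keepFirst s = (indicator v l).reverse) :
    ∃ s' T, keepFirst s' = (indicator v (l ++ [a])).reverse ∧
      T + leastCost v (l ++ [a]) ≤ 4 * (encodeWeight (v a)).length + leastCost v l ∧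
      Within T (cfg .start (best v l).isNone (encodeWeight (v a) ++ i) 0 0 (leastCost v l) s o)
        (cfg .start (best v (l ++ [a])).isNone i 0 0 (leastCost v (l ++ [a])) s' o) := by
  have hlen : s.length = l.length := by
    have := congrArg List.length hs
    simpa [length_keepFirst, indicator] using this
  by_cases h0 : v a = 0
  · have hb := best_concat_of_zero (l := l) h0
    have hc : leastCost v (l ++ [a]) = leastCost v l := by rw [leastCost, hb, leastCost]
    refine ⟨false :: s, 4, ?_, ?_, ?_⟩
    · rw [indicator_concat_of_eq ha hb, keepFirst, hs]
    · rw [hc, h0]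
      simp [encodeWeight]
    · rw [hc, hb, h0]
      exact weight_run_zero ..
  have hlen' : cost (v a) + 3 ≤ (encodeWeight (v a)).length := by
    simp [encodeWeight, cost]
    omega
  have hread := fun f b => weight_run_read f i b s o hv h0
  cases hl : best v l with
  | none =>
    have hb := best_concat_of_none h0 hl
    have hc : leastCost v l = 0 := by rw [leastCost, hl]; rfl
    rw [hc]
    have hc' : leastCost v (l ++ [a]) = cost (v a) := by rw [leastCost, hb]; rfl
    have hrun := (((hread true 0).trans (cmp_run_fresh ..)).trans (flush_run ..)).trans
      (restore_run ..)
    rw [Nat.zero_add (cost _), Nat.zero_add (cost _)] at hrun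
    rw [hc', hb]
    refine ⟨true :: s, _, ?_, ?_, hrun⟩
    · rw [indicator_concat_of_some ha hb, keepFirst, hlen]
    · omega
  | some e =>
    have hb := best_concat_of_some h0 hl
    have hmin : leastCost v (l ++ [a]) = min (cost (v a)) (cost (v e)) := by
      rw [leastCost, hb]
      split_ifs with h
      · exact (min_eq_left h.le).symm
      · exact (min_eq_right (not_lt.1 h)).symm
    have hnone : (best v (l ++ [a])).isNone = false := by
      rw [hb]; split_ifs <;> rfl
    have hc : leastCost v l = cost (v e) := by rw [leastCost, hl]; rfl
    rw [hc]
    have hrun := (((hread false (cost (v e))).trans (cmp_run ..)).trans (flush_run ..)).trans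
      (restore_run ..)
    rw [Nat.zero_add (min _ _), Nat.zero_add (min _ _)] at hrun
    rw [hmin, hnone]
    refine ⟨decide (cost (v a) < cost (v e)) :: s, _, ?_, ?_, hrun⟩
    · by_cases h : cost (v a) < cost (v e)
      · rw [if_pos h] at hb
        rw [indicator_concat_of_some ha hb, decide_eq_true h, keepFirst, hlen]
      · rw [if_neg h, ← hl] at hb
        rw [indicator_concat_of_eq ha hb, decide_eq_false h, keepFirst, hs]
    · omega

/-- The main loop. -/
lemma weights_run [DecidableEq α] {v : α → ℚ} (l l' : List α) (hl : (l ++ l').Nodup)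
    (hv : ∀ a, v a ∈ Set.Icc (0 : ℚ) 1) (hs : keepFirst s = (indicator v l).reverse) :
    ∃ s' T, keepFirst s' = (indicator v (l ++ l')).reverse ∧
      T + leastCost v (l ++ l') ≤
        4 * (l'.flatMap fun a => encodeWeight (v a)).length + leastCost v l ∧
      Within T (cfg .start (best v l).isNone ((l'.flatMap fun a => encodeWeight (v a)) ++ i) 0 0
          (leastCost v l) s o)
        (cfg .start (best v (l ++ l')).isNone i 0 0 (leastCost v (l ++ l')) s' o) := by
  induction l' generalizing l s with
  | nil => exact ⟨s, 0, by simpa using hs, by simp, by simpa using .refl _⟩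
  | cons a l' ih =>
    have ha : a ∉ l := fun h => (List.nodup_append.1 hl).2.2 a h a (by simp) rfl
    obtain ⟨s₁, T₁, h1, h2, h3⟩ := weight_run
      ((l'.flatMap fun a => encodeWeight (v a)) ++ i) s o ha (hv a) hs
    obtain ⟨s₂, T₂, h4, h5, h6⟩ := ih s₁ (l ++ [a]) (by simpa using hl) h1
    rw [List.append_assoc, List.singleton_append] at h4 h5 h6
    refine ⟨s₂, T₁ + T₂, h4, ?_, ?_⟩
    · simp only [List.flatMap_cons, List.length_append]
      omega
    · rw [List.flatMap_cons, List.append_assoc]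
      exact h3.trans h6

lemma fin_run :
    Within (b + 1) (cfg .fin f i c d b s o) (cfg .emit true i c d 0 s o) := by
  induction b with
  | zero => exact .one (by simp [cfg])
  | succ b ih => exact .head (by simp [cfg]) ih

lemma emit_run_false :
    Within s.length (cfg .emit false i c d b s o)
      (cfg .emit false i c d b [] (List.replicate s.length false ++ o)) := by
  induction s generalizing o with
  | nil => exact .refl _
  | cons a s ih =>
    have := ih (false :: o)
    rw [← List.singleton_append, ← List.append_assoc, ← List.replicate_succ'] at this
    exact .head (by simp [cfg]) this

lemma emit_run :
    ∃ f', Within s.length (cfg .emit true i c d b s o)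
      (cfg .emit f' i c d b [] ((keepFirst s).reverse ++ o)) := by
  induction s generalizing o with
  | nil => exact ⟨true, .refl _⟩
  | cons a s ih =>
    cases a with
    | true =>
      refine ⟨false, .head (y := cfg .emit false i c d b s (true :: o)) (by simp [cfg]) ?_⟩
      simpa [keepFirst] using emit_run_false i c d b s (true :: o)
    | false =>
      obtain ⟨f', h⟩ := ih (false :: o)
      refine ⟨f', .head (y := cfg .emit true i c d b s (false :: o)) (by simp [cfg]) ?_⟩
      simpa [keepFirst] using h

lemma initList_eq : initList tm i = cfg .skip₁ true i 0 0 0 [] [] := by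
  refine congrArg (TM2.Cfg.mk _ _) ?_
  funext k
  cases k <;> rfl

lemma emit_halt : TM2.stepAux (prog .emit) (clean f) (stk [] 0 0 0 [] o) = haltList tm o := by
  have : haltList tm o = ⟨none, clean true, stk [] 0 0 0 [] o⟩ := by
    refine congrArg (TM2.Cfg.mk _ _) ?_
    funext k
    cases k <;> rfl
  rw [this]
  simp
  rfl

/-- On two words without commas and a list of weights, the machine writes the indicator of the
chosen weight in linear time. -/
lemma run [DecidableEq α] (v : α → ℚ) (l : List α) (hl : l.Nodup)
    (hv : ∀ a, v a ∈ Set.Icc (0 : ℚ) 1) (w₁ w₂ : List Γ') (h₁ : Γ'.comma ∉ w₁)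
    (h₂ : Γ'.comma ∉ w₂) :
    let w := w₁ ++ Γ'.comma :: w₂ ++ Γ'.comma :: l.flatMap fun a => encodeWeight (v a)
    Within (5 * w.length + 5) (initList tm w) (haltList tm (indicator v l)) := by
  intro w
  have hlen : l.length ≤ (l.flatMap fun a => encodeWeight (v a)).length := by
    rw [List.length_flatMap]
    calc l.length = (l.map fun _ => 1).sum := by simp
      _ ≤ _ := List.sum_le_sum fun a _ => by simp [encodeWeight]
  obtain ⟨s, T, h3, h4, h5⟩ := weights_run [] [] [] [] l hl hv rfl
  obtain ⟨f, h6⟩ := emit_run [] 0 0 0 s []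
  rw [List.append_nil] at h5 h6
  rw [List.nil_append] at h3 h4 h5
  have hs : s.length = l.length := by
    have := congrArg List.length h3
    simpa [length_keepFirst, indicator] using this
  rw [h3, List.reverse_reverse] at h6
  have hstart := skip₂_run true (l.flatMap fun a => encodeWeight (v a)) 0 0 0 [] [] w₂ h₂
  have hskip := skip₁_run true (w₂ ++ Γ'.comma :: l.flatMap fun a => encodeWeight (v a))
    0 0 0 [] [] w₁ h₁
  have hfin : Within 1 (cfg .start (best v l).isNone [] 0 0 (leastCost v l) s [])
      (cfg .fin (best v l).isNone [] 0 0 (leastCost v l) s []) := .one (by simp [cfg])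
  have hinit : initList tm w = cfg .skip₁ true
      (w₁ ++ Γ'.comma :: (w₂ ++ Γ'.comma :: l.flatMap fun a => encodeWeight (v a)))
      0 0 0 [] [] := by
    rw [initList_eq]
    simp [w]
    rfl
  rw [hinit]
  have h0 : leastCost v [] = 0 := rfl
  refine ((((((hskip.trans hstart).trans h5).trans hfin).trans (fin_run ..)).trans h6).trans
    (.one (emit_halt ..))).mono ?_
  simp only [w, List.length_append, List.length_cons]
  omega

end Machine

/-! ### The approximation -/

namespace Instance

variable (I : Instance)

/-- All pairs of vertices, in the order in which their weights are written. -/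
def pairs : List (I.G₁.V × I.G₂.V) :=
  (List.finRange I.G₁.n).flatMap fun i => (List.finRange I.G₂.n).map fun j => (i, j)

lemma nodup_pairs : I.pairs.Nodup :=
  (List.nodup_finRange _).product (List.nodup_finRange _)

lemma mem_pairs (p : I.G₁.V × I.G₂.V) : p ∈ I.pairs := by
  simp [pairs]

/-- The candidate edge of a pair of vertices. -/
def edge (p : I.G₁.V × I.G₂.V) : I.Edge := (p.1, p.2, I.w p.1 p.2)

/-- The weight of a pair of vertices. -/
def val (p : I.G₁.V × I.G₂.V) : ℚ := I.w p.1 p.2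

/-- The solution of the algorithm: a single edge of least cost, or no edge if all weights
vanish. -/
def approx : Finset I.Edge := ((best I.val I.pairs).map I.edge).toFinset

lemma edge_injective : Function.Injective I.edge := by
  rintro ⟨a, b⟩ ⟨c, d⟩ h
  simp only [edge, Prod.mk.injEq] at h
  rw [h.1, h.2.1]

lemma card_beta : I.beta.card = I.G₁.n * I.G₂.n := by
  have h := Finset.card_image_of_injective Finset.univ I.edge_injective
  rw [Finset.card_univ, Fintype.card_prod, Fintype.card_fin, Fintype.card_fin] at h
  exact h

lemma encodeSolution_approx : encodeSolution I I.approx = indicator I.val I.pairs := by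
  have h : ∀ p, decide (I.edge p ∈ I.approx) = decide (best I.val I.pairs = some p) := by
    intro p
    rw [decide_eq_decide, approx, Option.mem_toFinset, Option.mem_def, Option.map_eq_some_iff]
    constructor
    · rintro ⟨q, hq, h⟩
      rw [hq, I.edge_injective h]
    · exact fun h => ⟨p, h, rfl⟩
  rw [indicator, ← funext h, pairs, List.map_flatMap, encodeSolution]
  simp only [List.map_map]
  rfl

lemma encodeInstance_eq : encodeInstance I = encodeDAG I.G₁ ++ Γ'.comma :: encodeDAG I.G₂ ++
    Γ'.comma :: I.pairs.flatMap fun p => encodeWeight (I.val p) := by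
  simp [encodeInstance, pairs, List.flatMap_assoc, List.flatMap_map, val]

lemma isAlignment_approx : I.IsAlignment I.approx := by
  have h : ∀ e ∈ I.approx, ∀ d ∈ I.approx, e = d := by
    intro e he d hd
    rw [approx, Option.mem_toFinset] at he hd
    exact Option.mem_unique he hd
  refine ⟨fun e he => ?_, fun e he d hd hne => absurd (h e he d hd) hne, fun e he => ?_⟩
  · rw [approx, Option.mem_toFinset, Option.mem_map] at he
    obtain ⟨p, -, rfl⟩ := he
    exact Finset.mem_image_of_mem _ (Finset.mem_univ p)
  · rw [Set.eq_empty_iff_forall_notMem]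
    rintro d ⟨⟨-, hd, -⟩, hdM⟩
    exact hd (h d hdM e he)

variable {I}

/-- An alignment is a matching of `G₁.n` vertices with `G₂.n` vertices, so that it is much smaller
than the set of all candidate edges. -/
lemma IsAlignment.card_sq_le {M : Finset I.Edge} (hM : I.IsAlignment M) :
    M.card ^ 2 ≤ I.beta.card := by
  have h1 : M.card ≤ I.G₁.n := by
    have := Finset.card_le_card_of_injOn (s := M) (t := Finset.univ) (fun e => e.1)
      (fun _ _ => by simp) fun e he d hd h => by
        by_contra hne
        exact (hM.matching e he d hd hne).1 h
    simpa using this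
  have h2 : M.card ≤ I.G₂.n := by
    have := Finset.card_le_card_of_injOn (s := M) (t := Finset.univ) (fun e => e.2.1)
      (fun _ _ => by simp) fun e he d hd h => by
        by_contra hne
        exact (hM.matching e he d hd hne).2 h
    simpa using this
  rw [card_beta, sq]
  exact Nat.mul_le_mul h1 h2

/-- Every weight is at most four times that of the chosen edge. -/
lemma IsAlignment.weight_le {M : Finset I.Edge} (hM : I.IsAlignment M) :
    I.weight M ≤ 4 * M.card * I.weight I.approx := by
  have hedge : ∀ e ∈ M, ∃ p, I.edge p = e := by
    intro e he
    obtain ⟨p, -, rfl⟩ := Finset.mem_image.1 (hM.subset he)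
    exact ⟨p, rfl⟩
  suffices h : ∀ e ∈ M, e.2.2 ≤ 4 * I.weight I.approx by
    have := Finset.sum_le_card_nsmul M (fun e => e.2.2) _ h
    rw [nsmul_eq_mul] at this
    rw [weight]
    linarith
  intro e he
  obtain ⟨p, rfl⟩ := hedge e he
  change I.val p ≤ _
  cases hb : best I.val I.pairs with
  | none =>
    simp [approx, hb, weight, eq_zero_of_best_eq_none hb (I.mem_pairs p)]
  | some q =>
    have hw : I.weight I.approx = I.val q := by
      simp [approx, hb, weight, edge, val]
    rw [hw]
    by_cases h0 : I.val p = 0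
    · rw [h0]
      exact mul_nonneg (by norm_num) (I.w_mem _ _).1
    · exact le_four_mul_of_cost_le (I.w_mem _ _) (I.w_mem _ _) (best_ne_zero hb) h0
        (best_cost_le hb (I.mem_pairs p) h0)

end Instance

lemma comma_notMem_encodeDAG (G : DAG) : Γ'.comma ∉ encodeDAG G := by
  simp [encodeDAG]

lemma isPolyTime_approx : IsPolyTime Instance.approx := by
  refine ⟨⟨⟨Machine.tm, Equiv.refl Γ', Equiv.refl Bool⟩, 5 * Polynomial.X + 5, fun I => ?_⟩⟩
  have h := Machine.run I.val I.pairs I.nodup_pairs (fun _ => I.w_mem _ _) _ _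
    (comma_notMem_encodeDAG I.G₁) (comma_notMem_encodeDAG I.G₂)
  rw [← I.encodeInstance_eq, ← I.encodeSolution_approx] at h
  have congr_words : ∀ {u u' : List Γ'} {t t' : List Bool}, u = u' → t = t' →
      Nonempty (TM2OutputsInTime Machine.tm u' (some t') (5 * (encodeInstance I).length + 5)) →
      Nonempty (TM2OutputsInTime Machine.tm u (some t) (5 * (encodeInstance I).length + 5)) := by
    rintro u u' t t' rfl rfl h
    exact h
  have ht : (5 * Polynomial.X + 5 : Polynomial ℕ).eval (encodeInstance I).length =
      5 * (encodeInstance I).length + 5 := by simp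
  rw [ht]
  exact (congr_words (List.map_id (encodeInstance I)) (List.map_id (encodeSolution I I.approx)) h).some

/-- The guarantee `4 √m` is of the required order, since `log² m = O(√m)`. -/
lemma isBigO_sqrt : (fun m : ℕ => 4 * √(m : ℝ)) =O[Filter.atTop]
    fun m : ℕ => (m : ℝ) / Real.log m ^ 2 := by
  have hlog : (fun m : ℕ => Real.log m ^ 2) =O[Filter.atTop] fun m : ℕ => √(m : ℝ) := by
    have h := ((isLittleO_log_rpow_atTop (r := 1 / 4) (by norm_num)).isBigO.pow 2).comp_tendsto
      tendsto_natCast_atTop_atTop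
    refine h.congr_right fun m => ?_
    simp only [Function.comp_apply]
    rw [Real.sqrt_eq_rpow, ← Real.rpow_natCast, ← Real.rpow_mul (Nat.cast_nonneg m)]
    norm_num
  obtain ⟨C, hC⟩ := hlog.bound
  refine .of_bound (4 * C) ?_
  filter_upwards [hC, Filter.eventually_gt_atTop 1] with m hm h1
  have hl : 0 < Real.log m := Real.log_pos (by exact_mod_cast h1)
  rw [Real.norm_of_nonneg (by positivity), Real.norm_of_nonneg (by positivity)] at hm ⊢
  rw [← mul_div_assoc, le_div_iff₀ (by positivity)]
  calc 4 * √(m : ℝ) * Real.log m ^ 2 ≤ 4 * √(m : ℝ) * (C * √(m : ℝ)) := by gcongr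
    _ = 4 * C * (√(m : ℝ) * √(m : ℝ)) := by ring
    _ = 4 * C * m := by rw [Real.mul_self_sqrt (Nat.cast_nonneg m)]

end DagAlignment

theorem theorem2 :
    ∃ ρ : ℕ → ℝ,
      Asymptotics.IsBigO Filter.atTop ρ (fun m : ℕ => (m : ℝ) / Real.log (m : ℝ) ^ 2) ∧
      DagAlignment.ApproximableWithin ρ := by
  refine ⟨_, DagAlignment.isBigO_sqrt, DagAlignment.Instance.approx,
    DagAlignment.isPolyTime_approx, fun I => ⟨I.isAlignment_approx, fun M hM => ?_⟩⟩
  have h1 : (I.weight M : ℝ) ≤ 4 * M.card * (I.weight I.approx : ℝ) := by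
    exact_mod_cast hM.weight_le
  have h2 : (M.card : ℝ) ≤ √(I.beta.card : ℝ) :=
    Real.le_sqrt_of_sq_le (by exact_mod_cast hM.card_sq_le)
  have h0 : (0 : ℝ) ≤ I.weight I.approx := by
    exact_mod_cast Finset.sum_nonneg fun e he => by
      obtain ⟨p, -, rfl⟩ := Finset.mem_image.1 (I.isAlignment_approx.subset he)
      exact (I.w_mem _ _).1
  exact h1.trans (mul_le_mul_of_nonneg_right (mul_le_mul_of_nonneg_left h2 (by norm_num)) h0)
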